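/- A graph is a finite directed multigraph $G=(V,E)$ (loops and repeated edges allowed) with node weights $b:V\to\mathbb{R}_{\ge 0}$. Write $\Gamma^-_v(G)$ for the multiset of incoming edges of $v$, $\deg^+_u(G)$ for the number of outgoing edges of $u$, and $\#_{(u,v)}(G)$ for the multiplicity of the edge $(u,v)$. A path has at least one edge; $\mathrm{dist}_{u,v}(G)$ is the number of edges of a shortest path from $u$ to $v$. $G$ is strongly connected if $V\neq\emptyset$ and there is a path from every node to every node (itself included); $\mathcal{SCG}$ denotes the class of these graphs. $\lambda(G)$ is the largest real eigenvalue of the matrix $A=(a_{u,v})$, $a_{u,v}=\#_{(v,u)}(G)$, and for $a\in(0,1)$, $\mathcal{KG}^a$ is the class of graphs with $\lambda(G)<1/a$. Distinct nodes $u,w$ are out-twins if $\#_{(u,t)}(G)=\#_{(w,t)}(G)$ for all $t\in V$. Then $R_{u\to w}(G,b)$ is obtained by deleting $u$ with all its incident edges, adding an edge $(v,w)$ for each former edge $(v,u)$ with $v\ne u$ (with multiplicity), giving $w$ the weight $b(u)+b(w)$ and keeping all other weights. A centrality measure $F$ defined on a class $\mathcal{G}$ satisfies *Node Redirect on $\mathcal{G}$*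 if for all $G\in\mathcal{G}$, weights $b$ and out-twins $u,w$ such that the graph of $R_{u\to w}(G,b)$ is in $\mathcal{G}$, $$F_v(G,b)=F_v(R_{u\to w}(G,b))\ \text{ for all } v\in V\setminus\{u,w\},\qquad F_u(G,b)+F_w(G,b)=F_w(R_{u\to w}(G,b)).$$ **Proposition.** (1) Each of the following systems has, for every graph in the indicated class and all node weights, exactly one real solution, and that solution is non-negative; the centrality measure that it defines satisfies Node Redirect on that class: - eigenvector centrality, on $\mathcal{SCG}$: $x_v=\frac{1}{\lambda(G)}\sum_{(u,v)\in\Gamma^-_v(G)}x_u$ for all $v$, and $\sum_v x_v=1$; - Katz prestige, on $\mathcal{SCG}$: $x_v=\sum_{(u,v)\in\Gamma^-_v(G)}x_u/\deg^+_u(G)$ for all $v$, and $\sum_v x_v=1$; - Katz centrality, on $\mathcal{KG}^a$, for every $a\in(0,1)$: $x_v=a\sum_{(u,v)\in\Gamma^-_v(G)}x_u+b(v)$ for all $v$; - Bonacich centrality, on $\mathcal{KG}^a$, for every $a\in(0,1)$: $x_v=\sum_{(u,v)\in\Gamma^-_v(G)}(a\,x_u+b(u))$ for all $v$. (2) Node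 Redirect is not satisfied by degree centrality $D_v=|\Gamma^-_v(G)|$, the beta measure $\beta_v=\sum_{(u,v)\in\Gamma^-_v(G)}1/\deg^+_u(G)$, decay centrality $Y^a_v=\sum_{u\ne v}a^{\mathrm{dist}_{u,v}(G)}$ for any $a\in(0,1)$ (where $a^{\infty}=0$), and betweenness centrality $B_v=\sum_{s,t}\sigma_{st}(v)/\sigma_{st}$ (all on the class of all graphs), nor by closeness centrality $C_v=1/\sum_{u\ne v}\mathrm{dist}_{u,v}(G)$ on $\mathcal{SCG}$. Here the sum in $B_v$ runs over ordered pairs of distinct $s,t\in V\setminus\{v\}$ with $\sigma_{st}\neq 0$, $\sigma_{st}$ is the number of shortest paths from $s$ to $t$ (parallel edges giving different paths) and $\sigma_{st}(v)$ the number of those through $v$. Explicitly, let $G$ have three distinct nodes $u,v,w$, edges $(u,v),(w,v),(v,u),(v,w)$ and all weights $1$, and let $(G',b')=R_{u\to w}(G,b)$. Then $u,w$ are out-twins, both graphs are strongly connected, and the values at $v$ in $(G,b)$ and in $(G',b')$ are respectively $2$ and $1$ for $D$; $2$ and $1$ for $\beta$; $\tfrac12$ and $1$ for $C$; $2a$ and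 $a$ for $Y^a$, for every $a\in(0,1)$; and $2$ and $0$ for $B$. -/

import Mathlib

open scoped NNReal

noncomputable section

namespace CentralityAxioms

/-- A finite directed multigraph: a finite set of nodes and a multiset of ordered pairs of nodes.
Loops and repeated edges are allowed. -/
structure Multigraph (α : Type*) where
  nodes : Finset α
  edges : Multiset (α × α)
  fst_mem : ∀ e ∈ edges, e.1 ∈ nodes
  snd_mem : ∀ e ∈ edges, e.2 ∈ nodes

namespace Multigraph

variable {α : Type*} [DecidableEq α] (G : Multigraph α)

/-- The number of times the edge `(u, v)` appears. -/
def mult (u v : α) : ℕ := G.edges.count (u, v)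

/-- The multiset of outgoing edges of `v`. -/
def outEdges (v : α) : Multiset (α × α) := G.edges.filter fun e => e.1 = v

/-- The multiset of incoming edges of `v`. -/
def inEdges (v : α) : Multiset (α × α) := G.edges.filter fun e => e.2 = v

def outDegree (v : α) : ℕ := (G.outEdges v).card

/-- Distinct nodes with the same outgoing edges, counted with multiplicity. -/
def OutTwins (u w : α) : Prop :=
  u ∈ G.nodes ∧ w ∈ G.nodes ∧ u ≠ w ∧ ∀ t, G.mult u t = G.mult w t

/-- The graph obtained by redirecting `u` into `w`: delete `u` with all its incident edges, and for
every former edge `(v, u)` with `v ≠ u` add an edge `(v, w)`. -/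
def redirect (u w : α) (hw : w ∈ G.nodes) (huw : u ≠ w) : Multigraph α where
  nodes := G.nodes.erase u
  edges := (G.edges - G.outEdges u - G.inEdges u) +
    ((G.inEdges u).filter fun e => e.1 ≠ u).map fun e => (e.1, w)
  fst_mem := by
    intro e he
    rcases Multiset.mem_add.1 he with h | h
    · have h1 : e ∈ G.edges - G.outEdges u := Multiset.mem_of_le (Multiset.sub_le_self _ _) h
      rw [outEdges, Multiset.sub_filter_eq_filter_not, Multiset.mem_filter] at h1
      exact Finset.mem_erase.2 ⟨h1.2, G.fst_mem e h1.1⟩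
    · obtain ⟨f, hf, rfl⟩ := Multiset.mem_map.1 h
      have hf' := Multiset.mem_filter.1 hf
      exact Finset.mem_erase.2 ⟨hf'.2, G.fst_mem f (Multiset.mem_filter.1 hf'.1).1⟩
  snd_mem := by
    intro e he
    rcases Multiset.mem_add.1 he with h | h
    · have h1 : e ∈ G.edges - G.inEdges u := by
        rw [tsub_right_comm] at h
        exact Multiset.mem_of_le (Multiset.sub_le_self _ _) h
      rw [inEdges, Multiset.sub_filter_eq_filter_not, Multiset.mem_filter] at h1
      exact Finset.mem_erase.2 ⟨h1.2, G.snd_mem e h1.1⟩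
    · obtain ⟨f, hf, rfl⟩ := Multiset.mem_map.1 h
      exact Finset.mem_erase.2 ⟨huw.symm, hw⟩

/-- `p` lists the `k + 1` nodes of a path with `k ≥ 1` edges. -/
def IsPath (k : ℕ) (p : Fin (k + 1) → α) : Prop :=
  1 ≤ k ∧ ∀ i : Fin k, (p i.castSucc, p i.succ) ∈ G.edges

/-- There is a path with exactly `k` edges from `u` to `v`. -/
def HasPath (k : ℕ) (u v : α) : Prop :=
  ∃ p : Fin (k + 1) → α, G.IsPath k p ∧ p 0 = u ∧ p (Fin.last k) = v

/-- `v` is a successor of `u` (a node can be its own successor). -/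
def IsSuccessor (u v : α) : Prop := ∃ k, G.HasPath k u v

/-- The length of a shortest path from `u` to `v`, meaningful when `v` is a successor of `u`. -/
def dist (u v : α) : ℕ := sInf {k | G.HasPath k u v}

/-- Every node is a successor of every node, itself included. -/
def StronglyConnected : Prop :=
  G.nodes.Nonempty ∧ ∀ u ∈ G.nodes, ∀ v ∈ G.nodes, G.IsSuccessor u v

/-- The adjacency matrix, whose entry at `(u, v)` is the number of edges from `v` to `u`. -/
def adjMatrix : Matrix G.nodes G.nodes ℝ := Matrix.of fun u v => (G.mult v u : ℝ)

/-- The largest real eigenvalue of the adjacency matrix. -/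
def eigenMax : ℝ := sSup {c : ℝ | ∃ x : G.nodes → ℝ, x ≠ 0 ∧ G.adjMatrix.mulVec x = c • x}

/-- The class of graphs on which Katz and Bonacich centralities with decay factor `a` are defined. -/
def KatzClass (a : ℝ) : Prop := G.eigenMax < 1 / a

/-- The sequences of `k + 1` nodes of the graph that start in `s` and end in `t`. -/
def nodeSeqs (k : ℕ) (s t : α) : Finset (Fin (k + 1) → α) :=
  (Fintype.piFinset fun _ => G.nodes).filter fun p => p 0 = s ∧ p (Fin.last k) = t

/-- The number of paths with `k` edges from `s` to `t`. Parallel edges give different paths, so that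
a node sequence is counted as often as one can choose edges along it (never, if two consecutive
nodes are not joined by an edge). -/
def numPaths (k : ℕ) (s t : α) : ℕ :=
  ∑ p ∈ G.nodeSeqs k s t, ∏ i : Fin k, G.mult (p i.castSucc) (p i.succ)

/-- The number of paths with `k` edges from `s` to `t` that go through `v`. -/
def numPathsThrough (k : ℕ) (s t v : α) : ℕ :=
  ∑ p ∈ (G.nodeSeqs k s t).filter fun p => ∃ i, p i = v,
    ∏ i : Fin k, G.mult (p i.castSucc) (p i.succ)

/-- The number of shortest paths from `s` to `t`, for `s ≠ t`; it is `0` if there is no path. -/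
def numShortest (s t : α) : ℕ := G.numPaths (G.dist s t) s t

/-- The number of shortest paths from `s` to `t` that go through `v`, for `s ≠ t`. -/
def numShortestThrough (s t v : α) : ℕ := G.numPathsThrough (G.dist s t) s t v

end Multigraph

variable {α : Type*} [DecidableEq α]

/-- The weights after redirecting `u` into `w` (the value at the deleted node `u` is irrelevant). -/
def redirectWeights (b : α → ℝ≥0) (u w : α) : α → ℝ≥0 := Function.update b w (b u + b w)

/-- A centrality measure assigns a real number to a graph, node weights and a node of the graph.
Weights and values outside the set of nodes carry no meaning. -/
abbrev Centrality (α : Type*) := Multigraph α → (α → ℝ≥0) → α → ℝ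

/-- Node Redirect restricted to a class of graphs. -/
def NodeRedirectOn (C : Multigraph α → Prop) (F : Centrality α) : Prop :=
  ∀ (G : Multigraph α) (b : α → ℝ≥0) (u w : α) (h : G.OutTwins u w),
    C G → C (G.redirect u w h.2.1 h.2.2.1) →
      (∀ v ∈ G.nodes, v ≠ u → v ≠ w →
        F G b v = F (G.redirect u w h.2.1 h.2.2.1) (redirectWeights b u w) v) ∧
      F G b u + F G b w = F (G.redirect u w h.2.1 h.2.2.1) (redirectWeights b u w) w

/-- A system of conditions on a vector of values, depending on a weighted graph, has on every graph
of the class exactly one solution, and this solution is non-negative. -/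
def WellPosedOn (C : Multigraph α → Prop)
    (Sol : Multigraph α → (α → ℝ≥0) → (α → ℝ) → Prop) : Prop :=
  ∀ (G : Multigraph α) (b : α → ℝ≥0), C G →
    (∃! x, Sol G b x) ∧ ∀ x, Sol G b x → ∀ v ∈ G.nodes, 0 ≤ x v

/-! Measures given by a recursive system. A solution is a vector indexed by the nodes; here it is
extended by zero outside the set of nodes. -/

/-- The system that defines eigenvector centrality. -/
def IsEigenvector (G : Multigraph α) (_b : α → ℝ≥0) (x : α → ℝ) : Prop :=
  (∀ v ∈ G.nodes, x v = 1 / G.eigenMax * ((G.inEdges v).map fun e => x e.1).sum) ∧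
    ∑ v ∈ G.nodes, x v = 1 ∧ ∀ v ∉ G.nodes, x v = 0

/-- The system that defines Katz prestige. -/
def IsKatzPrestige (G : Multigraph α) (_b : α → ℝ≥0) (x : α → ℝ) : Prop :=
  (∀ v ∈ G.nodes, x v = ((G.inEdges v).map fun e => x e.1 / (G.outDegree e.1 : ℝ)).sum) ∧
    ∑ v ∈ G.nodes, x v = 1 ∧ ∀ v ∉ G.nodes, x v = 0

/-- The system that defines Katz centrality. -/
def IsKatz (a : ℝ) (G : Multigraph α) (b : α → ℝ≥0) (x : α → ℝ) : Prop :=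
  (∀ v ∈ G.nodes, x v = a * ((G.inEdges v).map fun e => x e.1).sum + (b v : ℝ)) ∧
    ∀ v ∉ G.nodes, x v = 0

/-- The system that defines Bonacich centrality. -/
def IsBonacich (a : ℝ) (G : Multigraph α) (b : α → ℝ≥0) (x : α → ℝ) : Prop :=
  (∀ v ∈ G.nodes, x v = ((G.inEdges v).map fun e => a * x e.1 + (b e.1 : ℝ)).sum) ∧
    ∀ v ∉ G.nodes, x v = 0

/-- The measure whose values are the solution of the given system. -/
def solutionOf (Sol : Multigraph α → (α → ℝ≥0) → (α → ℝ) → Prop) : Centrality α :=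
  fun G b => Classical.epsilon (Sol G b)

def eigenvectorCentrality : Centrality α := solutionOf IsEigenvector

def katzPrestige : Centrality α := solutionOf IsKatzPrestige

def katzCentrality (a : ℝ) : Centrality α := solutionOf (IsKatz a)

def bonacichCentrality (a : ℝ) : Centrality α := solutionOf (IsBonacich a)

/-! Measures given by explicit formulas. -/

def degreeCentrality : Centrality α := fun G _ v => ((G.inEdges v).card : ℝ)

def betaMeasure : Centrality α := fun G _ v =>
  ((G.inEdges v).map fun e => 1 / (G.outDegree e.1 : ℝ)).sum

/-- Considered on strongly connected graphs. -/
def closenessCentrality : Centrality α := fun G _ v =>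
  1 / ∑ u ∈ G.nodes.erase v, (G.dist u v : ℝ)

open Classical in
/-- Nodes from which `v` cannot be reached contribute zero. -/
def decayCentrality (a : ℝ) : Centrality α := fun G _ v =>
  ∑ u ∈ G.nodes.erase v, if G.IsSuccessor u v then a ^ G.dist u v else 0

/-- The sum ranges over the ordered pairs of distinct nodes `s`, `t` other than `v` such that there
is a path from `s` to `t`. -/
def betweennessCentrality : Centrality α := fun G _ v =>
  ∑ s ∈ G.nodes.erase v,
    ∑ t ∈ (G.nodes.erase v).filter fun t => s ≠ t ∧ G.numShortest s t ≠ 0,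
      (G.numShortestThrough s t v : ℝ) / (G.numShortest s t : ℝ)

/-- The graph with nodes `u`, `v`, `w` and edges `(u, v)`, `(w, v)`, `(v, u)`, `(v, w)`. -/
def exampleGraph (u v w : α) : Multigraph α where
  nodes := {u, v, w}
  edges := {(u, v), (w, v), (v, u), (v, w)}
  fst_mem := by simp
  snd_mem := by simp

theorem mem_exampleGraph (u v w : α) : w ∈ (exampleGraph u v w).nodes := by
  simp [exampleGraph]

end CentralityAxioms

end

/-!
For a non-negative square matrix `A`, let `r` be the infimum of the `s` such that `A p < s p`
entrywise for some positive vector `p`. For such `s`, comparing with `p` at the index of the extreme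
ratio shows that `A y ≤ s y` forces `y ≥ 0`; hence `s - A` is injective with non-negative inverse,
which settles the Katz and Bonacich systems with `s = 1 / a`. If `r` were not an eigenvalue, the
solution of `(r - A) y = 1` would be positive, and `r` would be an attained infimum, although a
strict inequality leaves room to decrease `s`. So `r` is the largest real eigenvalue. If `A` is
irreducible, zeros of a non-negative vector with `A x ≤ r x` spread to all entries; applied to
differences of vectors that touch at one entry, this makes the eigenvector for `r` positive and
unique up to scale, and no other eigenvalue has a non-negative eigenvector. The adjacency matrix
gives eigenvector centrality, the random walk matrix, whose `r` is `1`, Katz prestige.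

Redirecting `u` into an out-twin `w` acts on vectors by adding the entry of `u` to that of `w`.
Since out-twins send the same edges, this linear map commutes with summing over incoming edges, so
it takes solutions to solutions of the redirected system, and uniqueness identifies them.
-/

namespace CentralityAxioms

open Matrix Multigraph

section PerronFrobenius

variable {n : Type*} [Fintype n] {A : Matrix n n ℝ} {s t : ℝ} {p x y : n → ℝ}

theorem mem_spectrum_iff_exists_mulVec_eq_smul {K : Type*} [Field K] [DecidableEq n]
    {A : Matrix n n K} {c : K} : c ∈ spectrum K A ↔ ∃ x, x ≠ 0 ∧ A *ᵥ x = c • x := by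
  rw [← spectrum_toLin', ← Module.End.hasEigenvalue_iff_mem_spectrum]
  constructor
  · intro h
    obtain ⟨x, hx⟩ := h.exists_hasEigenvector
    exact ⟨x, hx.2, hx.apply_eq_smul⟩
  · rintro ⟨x, hx, h⟩
    exact Module.End.hasEigenvalue_of_hasEigenvector ⟨Module.End.mem_eigenspace_iff.2 h, hx⟩

theorem exists_smul_sub_mulVec_eq [DecidableEq n] (hs : s ∉ spectrum ℝ A) (b : n → ℝ) :
    ∃ y, s • y - A *ᵥ y = b := by
  obtain ⟨y, hy⟩ := mulVec_surjective_iff_isUnit.2 (spectrum.notMem_iff.1 hs) b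
  refine ⟨y, ?_⟩
  rw [← hy, sub_mulVec, Algebra.algebraMap_eq_smul_one, smul_mulVec, one_mulVec]

theorem mulVec_nonneg (hA : ∀ i j, 0 ≤ A i j) (hx : 0 ≤ x) : 0 ≤ A *ᵥ x := fun i =>
  dotProduct_nonneg_of_nonneg (hA i) hx

theorem mulVec_mono (hA : ∀ i j, 0 ≤ A i j) (h : x ≤ y) : A *ᵥ x ≤ A *ᵥ y := fun i =>
  dotProduct_le_dotProduct_of_nonneg_left h (hA i)

theorem abs_mulVec_le (hA : ∀ i j, 0 ≤ A i j) (x : n → ℝ) : |A *ᵥ x| ≤ A *ᵥ |x| := by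
  refine abs_le'.2 ⟨mulVec_mono hA (le_abs_self x), ?_⟩
  rw [← mulVec_neg]
  exact mulVec_mono hA (neg_le_abs x)

theorem exists_le_smul_and_eq {ι : Type*} [Finite ι] [Nonempty ι] {p : ι → ℝ} (hp : ∀ i, 0 < p i)
    (x : ι → ℝ) : ∃ c k, x ≤ c • p ∧ x k = c * p k := by
  obtain ⟨k, hk⟩ := Finite.exists_max fun i => x i / p i
  exact ⟨x k / p k, k, fun i => (div_le_iff₀ (hp i)).1 (hk i),
    (div_mul_cancel₀ _ (hp k).ne').symm⟩

/-- The numbers `s` for which some positive vector `p` satisfies `A p < s p` in every entry. For a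
non-negative matrix the infimum is the Perron root, by the Collatz–Wielandt formula. -/
def collatzWielandtSet (A : Matrix n n ℝ) : Set ℝ :=
  {s | ∃ p : n → ℝ, (∀ i, 0 < p i) ∧ ∀ i, (A *ᵥ p) i < s * p i}

/-- The largest real eigenvalue of a non-negative matrix, see `isGreatest_spectrum_perronRoot`. -/
noncomputable def perronRoot (A : Matrix n n ℝ) : ℝ := sInf (collatzWielandtSet A)

theorem mem_collatzWielandtSet_of_mulVec_le (hp : ∀ i, 0 < p i) (h : A *ᵥ p ≤ s • p)
    (hst : s < t) : t ∈ collatzWielandtSet A :=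
  ⟨p, hp, fun i => (h i).trans_lt (mul_lt_mul_of_pos_right hst (hp i))⟩

theorem collatzWielandtSet_nonempty (A : Matrix n n ℝ) : (collatzWielandtSet A).Nonempty := by
  obtain ⟨C, hC⟩ := Finite.exists_le (A *ᵥ 1)
  exact ⟨C + 1, mem_collatzWielandtSet_of_mulVec_le (p := 1) (fun _ => one_pos)
    (fun i => by simpa using hC i) (lt_add_one C)⟩

/-- At the index where the ratio of `-y` to `p` is largest, `A p < s p` contradicts `A y ≤ s y`
unless that ratio is at most zero. -/
theorem nonneg_of_mulVec_le (hA : ∀ i j, 0 ≤ A i j) (hs : s ∈ collatzWielandtSet A)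
    (hy : A *ᵥ y ≤ s • y) : 0 ≤ y := by
  obtain ⟨p, hp, hps⟩ := hs
  intro i
  have : Nonempty n := ⟨i⟩
  obtain ⟨c, k, hle, hk⟩ := exists_le_smul_and_eq hp (-y)
  have hc : c ≤ 0 := by
    by_contra! hc
    have hk' : s * -y k < s * -y k :=
      calc s * -y k = -(s * y k) := mul_neg ..
        _ ≤ (A *ᵥ -y) k := by simpa [mulVec_neg] using hy k
        _ ≤ c * (A *ᵥ p) k := by simpa [mulVec_smul] using mulVec_mono hA hle k
        _ < c * (s * p k) := mul_lt_mul_of_pos_left (hps k) hc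
        _ = s * -y k := by rw [mul_left_comm, ← hk, Pi.neg_apply]
    exact hk'.false
  exact neg_nonpos.1 ((hle i).trans (mul_nonpos_of_nonpos_of_nonneg hc (hp i).le))

theorem eq_zero_of_mulVec_eq_smul (hA : ∀ i j, 0 ≤ A i j) (hs : s ∈ collatzWielandtSet A)
    (hy : A *ᵥ y = s • y) : y = 0 :=
  le_antisymm (neg_nonneg.1 <| nonneg_of_mulVec_le hA hs <| by rw [mulVec_neg, hy, smul_neg])
    (nonneg_of_mulVec_le hA hs hy.le)

theorem isClosed_setOf_exists_mem_stdSimplex_mulVec_le (A : Matrix n n ℝ) :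
    IsClosed {s : ℝ | ∃ x ∈ stdSimplex ℝ n, A *ᵥ x ≤ s • x} := by
  have hclosed : IsClosed {q : ℝ × stdSimplex ℝ n | A *ᵥ (q.2 : n → ℝ) ≤ q.1 • (q.2 : n → ℝ)} :=
    isClosed_le (by fun_prop) (by fun_prop)
  convert! isClosedMap_fst_of_compactSpace _ hclosed using 1
  ext s
  constructor
  · rintro ⟨x, hx, h⟩
    exact ⟨(s, ⟨x, hx⟩), h, rfl⟩
  · rintro ⟨⟨s, x, hx⟩, h, rfl⟩
    exact ⟨x, hx, h⟩

section Nonempty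

variable [Nonempty n]

theorem pos_of_mem_collatzWielandtSet (hA : ∀ i j, 0 ≤ A i j) (hs : s ∈ collatzWielandtSet A) :
    0 < s := by
  obtain ⟨p, hp, hps⟩ := hs
  obtain ⟨i⟩ := ‹Nonempty n›
  exact pos_of_mul_pos_left ((mulVec_nonneg hA (fun j => (hp j).le) i).trans_lt (hps i)) (hp i).le

theorem bddBelow_collatzWielandtSet (hA : ∀ i j, 0 ≤ A i j) : BddBelow (collatzWielandtSet A) :=
  ⟨0, fun _ hs => (pos_of_mem_collatzWielandtSet hA hs).le⟩

theorem perronRoot_nonneg (hA : ∀ i j, 0 ≤ A i j) : 0 ≤ perronRoot A :=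
  le_csInf (collatzWielandtSet_nonempty A) fun _ hs => (pos_of_mem_collatzWielandtSet hA hs).le

theorem exists_lt_mem_collatzWielandtSet (hs : s ∈ collatzWielandtSet A) :
    ∃ t ∈ collatzWielandtSet A, t < s := by
  obtain ⟨p, hp, hps⟩ := hs
  obtain ⟨c, k, hle, hk⟩ := exists_le_smul_and_eq hp (A *ᵥ p)
  have hcs : c < s := lt_of_mul_lt_mul_right (hk ▸ hps k) (hp k).le
  obtain ⟨t, hct, hts⟩ := exists_between hcs
  exact ⟨t, mem_collatzWielandtSet_of_mulVec_le hp hle hct, hts⟩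

theorem perronRoot_notMem_collatzWielandtSet (hA : ∀ i j, 0 ≤ A i j) :
    perronRoot A ∉ collatzWielandtSet A := fun h =>
  have ⟨_, ht, hlt⟩ := exists_lt_mem_collatzWielandtSet h
  hlt.not_ge (csInf_le (bddBelow_collatzWielandtSet hA) ht)

theorem mem_collatzWielandtSet_iff (hA : ∀ i j, 0 ≤ A i j) :
    s ∈ collatzWielandtSet A ↔ perronRoot A < s := by
  constructor
  · intro hs
    refine (csInf_le (bddBelow_collatzWielandtSet hA) hs).lt_of_ne ?_
    rintro rfl
    exact perronRoot_notMem_collatzWielandtSet hA hs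
  · intro hs
    obtain ⟨t, ⟨p, hp, hpt⟩, hts⟩ := exists_lt_of_csInf_lt (collatzWielandtSet_nonempty A) hs
    exact mem_collatzWielandtSet_of_mulVec_le hp (fun i => (hpt i).le) hts

theorem perronRoot_mem_spectrum [DecidableEq n] (hA : ∀ i j, 0 ≤ A i j) :
    perronRoot A ∈ spectrum ℝ A := by
  by_contra hr
  obtain ⟨y, hy⟩ := exists_smul_sub_mulVec_eq hr 1
  have hAy : A *ᵥ y = perronRoot A • y - 1 := by rw [← hy, sub_sub_cancel]
  -- For `s` slightly above the infimum, `s y - A y = 1 + (s - perronRoot A) y` is still positive.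
  have hy0 : 0 ≤ y := by
    obtain ⟨c, k, hle, -⟩ := exists_le_smul_and_eq (p := fun _ => (1 : ℝ)) (fun _ => one_pos) (-y)
    have hc : 0 < |c| + 1 := by positivity
    refine nonneg_of_mulVec_le hA (s := perronRoot A + (|c| + 1)⁻¹)
      ((mem_collatzWielandtSet_iff hA).2 (lt_add_of_pos_right _ (inv_pos.2 hc))) fun i => ?_
    have hyi : -y i ≤ |c| + 1 := by
      have := hle i
      simp only [Pi.neg_apply, Pi.smul_apply, smul_eq_mul, mul_one] at this
      linarith [le_abs_self c]
    have : (|c| + 1)⁻¹ * -y i ≤ 1 := (inv_mul_le_one₀ hc).2 hyi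
    simp only [hAy, Pi.sub_apply, Pi.smul_apply, Pi.one_apply, smul_eq_mul]
    linarith
  have hlt : ∀ i, (A *ᵥ y) i < perronRoot A * y i := fun i => by
    simp [hAy]
  have hpos : ∀ i, 0 < y i := fun i =>
    pos_of_mul_pos_right ((mulVec_nonneg hA hy0 i).trans_lt (hlt i)) (perronRoot_nonneg hA)
  exact perronRoot_notMem_collatzWielandtSet hA ⟨y, hpos, hlt⟩

theorem isGreatest_spectrum_perronRoot [DecidableEq n] (hA : ∀ i j, 0 ≤ A i j) :
    IsGreatest (spectrum ℝ A) (perronRoot A) := by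
  refine ⟨perronRoot_mem_spectrum hA, fun c hc => ?_⟩
  by_contra! h
  obtain ⟨x, hx, hAx⟩ := mem_spectrum_iff_exists_mulVec_eq_smul.1 hc
  exact hx (eq_zero_of_mulVec_eq_smul hA ((mem_collatzWielandtSet_iff hA).2 h) hAx)

theorem inv_sum_smul_mem_stdSimplex (hp : ∀ i, 0 < p i) : (∑ i, p i)⁻¹ • p ∈ stdSimplex ℝ n := by
  have hsum : 0 < ∑ i, p i := Finset.sum_pos (fun i _ => hp i) Finset.univ_nonempty
  refine ⟨fun i => (mul_pos (inv_pos.2 hsum) (hp i)).le, ?_⟩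
  simp only [Pi.smul_apply, smul_eq_mul, ← Finset.mul_sum, inv_mul_cancel₀ hsum.ne']

theorem exists_mem_stdSimplex_mulVec_le_perronRoot_smul (hA : ∀ i j, 0 ≤ A i j) :
    ∃ x ∈ stdSimplex ℝ n, A *ᵥ x ≤ perronRoot A • x := by
  refine (isClosed_setOf_exists_mem_stdSimplex_mulVec_le A).closure_subset_iff.2 ?_
    (csInf_mem_closure (collatzWielandtSet_nonempty A) (bddBelow_collatzWielandtSet hA))
  rintro s ⟨p, hp, hps⟩
  refine ⟨(∑ i, p i)⁻¹ • p, inv_sum_smul_mem_stdSimplex hp, ?_⟩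
  rw [mulVec_smul, smul_comm]
  exact smul_le_smul_of_nonneg_left (fun i => (hps i).le)
    (inv_nonneg.2 (Finset.sum_nonneg fun i _ => (hp i).le))

end Nonempty

theorem mem_collatzWielandtSet_of_sSup_spectrum_lt [DecidableEq n] (hA : ∀ i j, 0 ≤ A i j)
    (h : sSup (spectrum ℝ A) < s) : s ∈ collatzWielandtSet A := by
  cases isEmpty_or_nonempty n
  · exact ⟨0, isEmptyElim, isEmptyElim⟩
  · exact (mem_collatzWielandtSet_iff hA).2 ((isGreatest_spectrum_perronRoot hA).csSup_eq ▸ h)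

theorem exists_nonneg_forall_eq_smul_mulVec_add_iff {a : ℝ} {b : n → ℝ} (hA : ∀ i j, 0 ≤ A i j)
    (ha : 0 < a) (h : 1 / a ∈ collatzWielandtSet A) (hb : 0 ≤ b) :
    ∃ y, 0 ≤ y ∧ ∀ x, x = a • A *ᵥ x + b ↔ x = y := by
  classical
  have hspec : 1 / a ∉ spectrum ℝ A := fun hmem =>
    have ⟨x, hx, hAx⟩ := mem_spectrum_iff_exists_mulVec_eq_smul.1 hmem
    hx (eq_zero_of_mulVec_eq_smul hA h hAx)
  obtain ⟨y, hy⟩ := exists_smul_sub_mulVec_eq hspec ((1 / a) • b)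
  have hy' : y = a • A *ᵥ y + b := by
    have := congrArg (a • ·) hy
    simpa [smul_sub, smul_smul, ha.ne', sub_eq_iff_eq_add'] using this
  have hAy : A *ᵥ y ≤ (1 / a) • y := by
    rw [← sub_nonneg, hy]
    exact smul_nonneg (one_div_pos.2 ha).le hb
  refine ⟨y, nonneg_of_mulVec_le hA h hAy, fun x => ⟨fun hx => ?_, fun hx => hx ▸ hy'⟩⟩
  have hxy : x - y = a • A *ᵥ (x - y) := by
    rw [mulVec_sub, smul_sub]
    nth_rewrite 1 [hx, hy']
    abel
  refine sub_eq_zero.1 (eq_zero_of_mulVec_eq_smul hA h ?_)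
  nth_rewrite 2 [hxy]
  rw [smul_smul, one_div_mul_cancel ha.ne', one_smul]

end PerronFrobenius

section Irreducible

variable {n : Type*} [Fintype n] {A : Matrix n n ℝ} {r : ℝ} {p x y : n → ℝ}

/-- Zeros of `x` spread along the edges of the quiver of `A`, which is strongly connected. -/
theorem eq_zero_of_mulVec_le_smul (hA : A.IsIrreducible) (hx : 0 ≤ x) (hAx : A *ᵥ x ≤ r • x)
    {i : n} (hi : x i = 0) : x = 0 := by
  have step : ∀ j k, x j = 0 → 0 < A j k → x k = 0 := by
    intro j k hj hjk
    have hsum : (A *ᵥ x) j ≤ 0 := by simpa [hj] using hAx j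
    have hterm : A j k * x k ≤ (A *ᵥ x) j := Finset.single_le_sum (f := fun l => A j l * x l)
      (fun l _ => mul_nonneg (hA.nonneg j l) (hx l)) (Finset.mem_univ k)
    exact le_antisymm (nonpos_of_mul_nonpos_right (hterm.trans hsum) hjk) (hx k)
  let : Quiver n := toQuiver A
  ext j
  obtain ⟨path, -⟩ := hA.connected i j
  induction path with
  | nil => exact hi
  | cons _ e ih => exact step _ _ ih e.down

theorem pos_of_mulVec_le_smul (hA : A.IsIrreducible) (hx : 0 ≤ x) (hx0 : x ≠ 0)
    (hAx : A *ᵥ x ≤ r • x) (i : n) : 0 < x i :=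
  (hx i).lt_of_ne fun hi => hx0 (eq_zero_of_mulVec_le_smul hA hx hAx hi.symm)

variable [Nonempty n]

theorem exists_eq_smul_of_mulVec_eq_smul (hA : A.IsIrreducible) (hp : ∀ i, 0 < p i)
    (hAp : A *ᵥ p = r • p) (hAx : A *ᵥ x = r • x) : ∃ c : ℝ, x = c • p := by
  obtain ⟨c, k, hle, hk⟩ := exists_le_smul_and_eq hp x
  have hzero : c • p - x = 0 := by
    refine eq_zero_of_mulVec_le_smul hA (sub_nonneg.2 hle) (r := r) (i := k) ?_ (by simp [hk])
    rw [mulVec_sub, mulVec_smul, hAp, hAx, smul_sub, smul_comm]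
  exact ⟨c, (sub_eq_zero.1 hzero).symm⟩

theorem exists_pos_mulVec_eq_perronRoot_smul (hA : A.IsIrreducible) :
    ∃ p, (∀ i, 0 < p i) ∧ A *ᵥ p = perronRoot A • p := by
  classical
  set r := perronRoot A
  obtain ⟨x, hx, hAx⟩ := exists_mem_stdSimplex_mulVec_le_perronRoot_smul hA.nonneg
  have hxpos : ∀ i, 0 < x i :=
    pos_of_mulVec_le_smul hA hx.1 (by rintro rfl; simpa using hx.2) hAx
  obtain ⟨z, hz, hAz⟩ :=
    mem_spectrum_iff_exists_mulVec_eq_smul.1 (perronRoot_mem_spectrum hA.nonneg)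
  have hAabs : r • |z| ≤ A *ᵥ |z| := by
    calc r • |z| = |A *ᵥ z| := by
          ext i
          simp [hAz, abs_mul, abs_of_nonneg (perronRoot_nonneg hA.nonneg), r]
      _ ≤ A *ᵥ |z| := abs_mulVec_le hA.nonneg z
  obtain ⟨c, k, hle, hk⟩ := exists_le_smul_and_eq hxpos |z|
  have hc : 0 ≤ c := nonneg_of_mul_nonneg_left (hk ▸ abs_nonneg (z k)) (hxpos k)
  have hAcx : A *ᵥ (c • x) ≤ r • c • x := by
    rw [mulVec_smul, smul_comm]
    exact smul_le_smul_of_nonneg_left hAx hc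
  have habs : c • x - |z| = 0 := by
    refine eq_zero_of_mulVec_le_smul hA (sub_nonneg.2 hle) (r := r) (i := k) ?_ (by simp [hk])
    rw [mulVec_sub, smul_sub]
    exact sub_le_sub hAcx hAabs
  rw [sub_eq_zero.1 habs] at hAcx
  exact ⟨|z|, pos_of_mulVec_le_smul hA (abs_nonneg z) (by simpa using hz) hAcx,
    hAcx.antisymm hAabs⟩

theorem perronRoot_pos (hA : A.IsIrreducible) : 0 < perronRoot A := by
  obtain ⟨p, hp, hAp⟩ := exists_pos_mulVec_eq_perronRoot_smul hA
  let : Quiver n := toQuiver A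
  obtain ⟨i⟩ := ‹Nonempty n›
  obtain ⟨path, hpath⟩ := hA.connected i i
  cases path with
  | nil => exact absurd hpath (lt_irrefl 0)
  | @cons j _ _ e =>
    have hAj : 0 < (A *ᵥ p) j := Finset.sum_pos' (fun k _ => mul_nonneg (hA.nonneg j k) (hp k).le)
      ⟨i, Finset.mem_univ i, mul_pos e.down (hp i)⟩
    rw [hAp] at hAj
    exact pos_of_mul_pos_left hAj (hp j).le

theorem perronRoot_eq_of_mulVec_eq_smul (hA : A.IsIrreducible) (hx : 0 ≤ x) (hx0 : x ≠ 0)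
    (hAx : A *ᵥ x = r • x) : perronRoot A = r := by
  classical
  apply le_antisymm
  · refine le_of_forall_gt fun s hs => (mem_collatzWielandtSet_iff hA.nonneg).1 ?_
    exact mem_collatzWielandtSet_of_mulVec_le (pos_of_mulVec_le_smul hA hx hx0 hAx.le) hAx.le hs
  · exact (isGreatest_spectrum_perronRoot hA.nonneg).2
      (mem_spectrum_iff_exists_mulVec_eq_smul.2 ⟨x, hx0, hAx⟩)

theorem exists_pos_forall_mulVec_eq_perronRoot_smul_iff (hA : A.IsIrreducible) :
    ∃ p, (∀ i, 0 < p i) ∧ ∀ x, A *ᵥ x = perronRoot A • x ∧ ∑ i, x i = 1 ↔ x = p := by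
  obtain ⟨p, hp, hAp⟩ := exists_pos_mulVec_eq_perronRoot_smul hA
  have hsum : 0 < ∑ i, p i := Finset.sum_pos (fun i _ => hp i) Finset.univ_nonempty
  refine ⟨(∑ i, p i)⁻¹ • p, fun i => mul_pos (inv_pos.2 hsum) (hp i), fun x => ⟨?_, ?_⟩⟩
  · rintro ⟨hAx, hx1⟩
    obtain ⟨c, rfl⟩ := exists_eq_smul_of_mulVec_eq_smul hA hp hAp hAx
    simp only [Pi.smul_apply, smul_eq_mul, ← Finset.mul_sum] at hx1
    rw [eq_inv_of_mul_eq_one_left hx1]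
  · rintro rfl
    exact ⟨by rw [mulVec_smul, hAp, smul_comm], (inv_sum_smul_mem_stdSimplex hp).2⟩

theorem perronRoot_eq_one_of_mem_colStochastic [DecidableEq n] (hA : A.IsIrreducible)
    (hA' : A ∈ colStochastic ℝ n) : perronRoot A = 1 := by
  obtain ⟨p, hp, hAp⟩ := exists_pos_mulVec_eq_perronRoot_smul hA
  have hsum : 0 < ∑ i, p i := Finset.sum_pos (fun i _ => hp i) Finset.univ_nonempty
  have h := sum_mulVec_of_mem_colStochastic (x := p) hA'
  simp only [hAp, Pi.smul_apply, smul_eq_mul, ← Finset.mul_sum] at h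
  exact (mul_eq_right₀ hsum.ne').1 h

end Irreducible

namespace Multigraph

variable {α : Type*} {G : Multigraph α} {u v w : α}

theorem StronglyConnected.exists_edge (hG : G.StronglyConnected) (hu : u ∈ G.nodes) :
    ∃ v, (u, v) ∈ G.edges := by
  obtain ⟨k, p, ⟨hk, hp⟩, rfl, -⟩ := hG.2 u hu u hu
  exact ⟨_, hp ⟨0, hk⟩⟩

theorem StronglyConnected.isIrreducible (hG : G.StronglyConnected)
    {A : Matrix G.nodes G.nodes ℝ} (hA : ∀ i j, 0 ≤ A i j)
    (hedge : ∀ i j : G.nodes, ((i : α), (j : α)) ∈ G.edges → 0 < A j i) : A.IsIrreducible := by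
  refine isIrreducible_transpose_iff.1 ⟨fun i j => hA j i, fun i j => ?_⟩
  let : Quiver G.nodes := toQuiver Aᵀ
  obtain ⟨k, p, ⟨hk, hp⟩, h0, hlast⟩ := hG.2 i i.2 j j.2
  have hpath : ∀ l : Fin (k + 1), ∃ hl : p l ∈ G.nodes,
      ∃ q : Quiver.Path i ⟨p l, hl⟩, q.length = l := by
    intro l
    induction l using Fin.induction with
    | zero =>
      obtain ⟨i, hi⟩ := i
      subst h0
      exact ⟨hi, .nil, rfl⟩
    | succ l ih =>
      obtain ⟨hl, q, hq⟩ := ih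
      exact ⟨G.snd_mem _ (hp l), q.cons ⟨hedge _ _ (hp l)⟩, congrArg (· + 1) hq⟩
  obtain ⟨j, hj⟩ := j
  subst hlast
  obtain ⟨_, q, hq⟩ := hpath (Fin.last k)
  exact ⟨q, hq ▸ hk⟩

variable [DecidableEq α]

/-- The sum of `f` over the tails of the edges into `v`, counted with multiplicity: the right-hand
side that the recursive centralities have in common. -/
noncomputable def inSum (G : Multigraph α) (f : α → ℝ) (v : α) : ℝ :=
  ((G.inEdges v).map fun e => f e.1).sum

theorem inSum_eq_sum_mult (G : Multigraph α) (f : α → ℝ) (v : α) :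
    G.inSum f v = ∑ t ∈ G.nodes, (G.mult t v : ℝ) * f t := by
  have hcount : ∀ t, ((G.inEdges v).map Prod.fst).count t = G.mult t v := fun t => by
    rw [Multiset.count_map, inEdges, Multiset.filter_filter, mult, Multiset.count_eq_card_filter_eq]
    exact congrArg _ (Multiset.filter_congr fun e _ => by grind)
  have hsub : ((G.inEdges v).map Prod.fst).toFinset ⊆ G.nodes := fun t ht => by
    obtain ⟨e, he, rfl⟩ := Multiset.mem_map.1 (Multiset.mem_toFinset.1 ht)
    exact G.fst_mem e (Multiset.mem_of_mem_filter he)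
  rw [inSum, ← Function.comp_def, ← Multiset.map_map, Finset.sum_multiset_map_count]
  simp only [hcount, nsmul_eq_mul]
  refine Finset.sum_subset hsub fun t _ ht => ?_
  rw [← hcount, Multiset.count_eq_zero.2 (mt Multiset.mem_toFinset.2 ht), Nat.cast_zero, zero_mul]

theorem inSum_nonneg {f : α → ℝ} (hf : 0 ≤ f) : 0 ≤ G.inSum f v :=
  inSum_eq_sum_mult G f v ▸ Finset.sum_nonneg fun t _ => mul_nonneg (Nat.cast_nonneg _) (hf t)

theorem outDegree_eq_sum_mult (G : Multigraph α) (u : α) :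
    G.outDegree u = ∑ t ∈ G.nodes, G.mult u t := by
  have hcount : ∀ t, ((G.outEdges u).map Prod.snd).count t = G.mult u t := fun t => by
    rw [Multiset.count_map, outEdges, Multiset.filter_filter, mult,
      Multiset.count_eq_card_filter_eq]
    exact congrArg _ (Multiset.filter_congr fun e _ => by grind)
  rw [outDegree, ← Multiset.card_map Prod.snd, ← Multiset.sum_count_eq_card (s := G.nodes)]
  · simp only [hcount]
  · intro t ht
    obtain ⟨e, he, rfl⟩ := Multiset.mem_map.1 ht
    exact G.snd_mem e (Multiset.mem_of_mem_filter he)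

theorem adjMatrix_nonneg (i j : G.nodes) : 0 ≤ G.adjMatrix i j := Nat.cast_nonneg _

theorem adjMatrix_mulVec (x : α → ℝ) (i : G.nodes) :
    (G.adjMatrix *ᵥ fun j => x j) i = G.inSum x i := by
  rw [inSum_eq_sum_mult, ← Finset.sum_coe_sort]
  rfl

theorem adjMatrix_mulVec_eq_smul_iff {x : α → ℝ} {r : ℝ} :
    G.adjMatrix *ᵥ (fun j => x j) = r • (fun j : G.nodes => x j) ↔
      ∀ v ∈ G.nodes, G.inSum x v = r * x v := by
  simp only [funext_iff, adjMatrix_mulVec, Subtype.forall, Pi.smul_apply, smul_eq_mul]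

theorem eigenMax_eq_sSup_spectrum (G : Multigraph α) :
    G.eigenMax = sSup (spectrum ℝ G.adjMatrix) :=
  congrArg sSup <| Set.ext fun _ => mem_spectrum_iff_exists_mulVec_eq_smul.symm

theorem StronglyConnected.isIrreducible_adjMatrix (hG : G.StronglyConnected) :
    G.adjMatrix.IsIrreducible :=
  hG.isIrreducible adjMatrix_nonneg fun _ _ h => Nat.cast_pos.2 (Multiset.count_pos.2 h)

theorem StronglyConnected.perronRoot_adjMatrix (hG : G.StronglyConnected) :
    perronRoot G.adjMatrix = G.eigenMax :=
  have := hG.1.to_subtype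
  (G.eigenMax_eq_sSup_spectrum.trans
    (isGreatest_spectrum_perronRoot adjMatrix_nonneg).csSup_eq).symm

theorem StronglyConnected.eigenMax_pos (hG : G.StronglyConnected) : 0 < G.eigenMax :=
  have := hG.1.to_subtype
  hG.perronRoot_adjMatrix ▸ perronRoot_pos hG.isIrreducible_adjMatrix

theorem StronglyConnected.eigenMax_eq_of_nonneg (hG : G.StronglyConnected) {x : α → ℝ} {r : ℝ}
    (hx : ∀ v ∈ G.nodes, 0 ≤ x v) (hsum : ∑ v ∈ G.nodes, x v ≠ 0)
    (heq : ∀ v ∈ G.nodes, G.inSum x v = r * x v) : G.eigenMax = r := by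
  have := hG.1.to_subtype
  rw [← hG.perronRoot_adjMatrix]
  refine perronRoot_eq_of_mulVec_eq_smul hG.isIrreducible_adjMatrix (x := fun i => x i)
    (fun i => hx i i.2) (fun h => hsum ?_) (adjMatrix_mulVec_eq_smul_iff.2 heq)
  exact Finset.sum_eq_zero fun v hv => congrFun h ⟨v, hv⟩

theorem KatzClass.mem_collatzWielandtSet {a : ℝ} (hG : G.KatzClass a) :
    1 / a ∈ collatzWielandtSet G.adjMatrix :=
  mem_collatzWielandtSet_of_sSup_spectrum_lt adjMatrix_nonneg (G.eigenMax_eq_sSup_spectrum ▸ hG)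

/-- The transition matrix of the random walk on the edges: its entry at `(v, u)` is the probability
of moving from `u` to `v`, in accordance with the orientation of `adjMatrix`. -/
noncomputable def walkMatrix (G : Multigraph α) : Matrix G.nodes G.nodes ℝ :=
  Matrix.of fun v u => (G.mult u v : ℝ) / (G.outDegree u : ℝ)

theorem walkMatrix_nonneg (i j : G.nodes) : 0 ≤ G.walkMatrix i j :=
  div_nonneg (Nat.cast_nonneg _) (Nat.cast_nonneg _)

theorem walkMatrix_mulVec (x : α → ℝ) (i : G.nodes) :
    (G.walkMatrix *ᵥ fun j => x j) i = G.inSum (fun t => x t / G.outDegree t) i := by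
  rw [inSum_eq_sum_mult, ← Finset.sum_coe_sort]
  exact Finset.sum_congr rfl fun t _ => div_mul_comm _ _ _ |>.trans (mul_comm _ _)

theorem StronglyConnected.outDegree_pos (hG : G.StronglyConnected) (hu : u ∈ G.nodes) :
    0 < G.outDegree u := by
  obtain ⟨v, huv⟩ := hG.exists_edge hu
  exact Multiset.card_pos_iff_exists_mem.2 ⟨(u, v), Multiset.mem_filter.2 ⟨huv, rfl⟩⟩

theorem StronglyConnected.isIrreducible_walkMatrix (hG : G.StronglyConnected) :
    G.walkMatrix.IsIrreducible :=
  hG.isIrreducible walkMatrix_nonneg fun i _ h =>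
    div_pos (Nat.cast_pos.2 (Multiset.count_pos.2 h)) (Nat.cast_pos.2 (hG.outDegree_pos i.2))

theorem StronglyConnected.walkMatrix_mem_colStochastic (hG : G.StronglyConnected) :
    G.walkMatrix ∈ colStochastic ℝ G.nodes := by
  refine mem_colStochastic_iff_sum.2 ⟨walkMatrix_nonneg, fun j => ?_⟩
  calc ∑ i, G.walkMatrix i j = ∑ t ∈ G.nodes, (G.mult j t : ℝ) / G.outDegree j :=
        Finset.sum_coe_sort G.nodes fun t => (G.mult j t : ℝ) / G.outDegree j
    _ = 1 := by
        rw [← Finset.sum_div, ← Nat.cast_sum, ← outDegree_eq_sum_mult,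
          div_self (Nat.cast_ne_zero.2 (hG.outDegree_pos j.2).ne')]

end Multigraph

section WellPosed

theorem existsUnique_and_nonneg_of_restrict {α : Type*} {N : Finset α}
    {P : (α → ℝ) → Prop} {Q : (N → ℝ) → Prop} (h : ∀ x, P x ↔ Q (fun i => x i) ∧ ∀ v ∉ N, x v = 0)
    (hQ : ∃ y, 0 ≤ y ∧ ∀ x, Q x ↔ x = y) : (∃! x, P x) ∧ ∀ x, P x → ∀ v ∈ N, 0 ≤ x v := by
  classical
  obtain ⟨y, hy, hQ⟩ := hQ
  simp only [h, hQ]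
  refine ⟨⟨fun v => if hv : v ∈ N then y ⟨v, hv⟩ else 0, ⟨by simp, fun v hv => dif_neg hv⟩, ?_⟩, ?_⟩
  · rintro x ⟨rfl, hx⟩
    ext v
    split_ifs with hv
    exacts [rfl, hx v hv]
  · rintro x ⟨rfl, -⟩ v hv
    exact hy ⟨v, hv⟩

variable {α : Type*} [DecidableEq α]

theorem wellPosedOn_isEigenvector :
    WellPosedOn (α := α) StronglyConnected IsEigenvector := by
  intro G b hG
  have := hG.1.to_subtype
  obtain ⟨p, hp, huniq⟩ :=
    exists_pos_forall_mulVec_eq_perronRoot_smul_iff hG.isIrreducible_adjMatrix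
  refine existsUnique_and_nonneg_of_restrict (fun x => ?_) ⟨p, fun i => (hp i).le, huniq⟩
  rw [adjMatrix_mulVec_eq_smul_iff, hG.perronRoot_adjMatrix, Finset.sum_coe_sort G.nodes x,
    IsEigenvector, and_assoc]
  refine and_congr_left' (forall₂_congr fun v _ => ?_)
  rw [one_div, eq_inv_mul_iff_mul_eq₀ hG.eigenMax_pos.ne', eq_comm]
  rfl

theorem wellPosedOn_isKatzPrestige :
    WellPosedOn (α := α) StronglyConnected IsKatzPrestige := by
  intro G b hG
  have := hG.1.to_subtype
  obtain ⟨p, hp, huniq⟩ :=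
    exists_pos_forall_mulVec_eq_perronRoot_smul_iff hG.isIrreducible_walkMatrix
  refine existsUnique_and_nonneg_of_restrict (fun x => ?_) ⟨p, fun i => (hp i).le, huniq⟩
  rw [perronRoot_eq_one_of_mem_colStochastic hG.isIrreducible_walkMatrix
    hG.walkMatrix_mem_colStochastic, one_smul, Finset.sum_coe_sort G.nodes x, IsKatzPrestige,
    and_assoc, funext_iff, Subtype.forall]
  refine and_congr_left' (forall₂_congr fun v hv => ?_)
  rw [walkMatrix_mulVec x ⟨v, hv⟩, eq_comm]
  rfl

/-- Katz and Bonacich centralities both have this form, with different right-hand sides `c`. -/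
theorem existsUnique_and_nonneg_of_katzClass {G : Multigraph α} {a : ℝ} (ha : 0 < a)
    (hG : G.KatzClass a) {c : α → ℝ} (hc : 0 ≤ c) {P : (α → ℝ) → Prop}
    (hP : ∀ x, P x ↔ (∀ v ∈ G.nodes, x v = a * G.inSum x v + c v) ∧ ∀ v ∉ G.nodes, x v = 0) :
    (∃! x, P x) ∧ ∀ x, P x → ∀ v ∈ G.nodes, 0 ≤ x v := by
  refine existsUnique_and_nonneg_of_restrict (fun x => (hP x).trans (and_congr_left' ?_))
    (exists_nonneg_forall_eq_smul_mulVec_add_iff (b := fun i : G.nodes => c i) adjMatrix_nonneg ha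
      hG.mem_collatzWielandtSet fun i => hc i)
  simp only [funext_iff, Subtype.forall, Pi.add_apply, Pi.smul_apply, adjMatrix_mulVec, smul_eq_mul]

theorem wellPosedOn_isKatz {a : ℝ} (ha : 0 < a) :
    WellPosedOn (α := α) (fun G => G.KatzClass a) (IsKatz a) := fun _ b hG =>
  existsUnique_and_nonneg_of_katzClass ha hG (c := fun v => b v) (fun v => (b v).2)
    fun _ => Iff.rfl

theorem isBonacich_iff {a : ℝ} {G : Multigraph α} {b : α → ℝ≥0} {x : α → ℝ} :
    IsBonacich a G b x ↔ (∀ v ∈ G.nodes, x v = a * G.inSum x v + G.inSum (fun t => b t) v) ∧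
      ∀ v ∉ G.nodes, x v = 0 := by
  simp only [IsBonacich, inSum, Multiset.sum_map_add, Multiset.sum_map_mul_left]

theorem wellPosedOn_isBonacich {a : ℝ} (ha : 0 < a) :
    WellPosedOn (α := α) (fun G => G.KatzClass a) (IsBonacich a) := fun G b hG =>
  existsUnique_and_nonneg_of_katzClass ha hG (c := G.inSum fun t => b t)
    (fun _ => inSum_nonneg fun t => (b t).2) fun _ => isBonacich_iff

end WellPosed

section Transfer

variable {α M : Type*} [DecidableEq α] [AddCommMonoid M] {N : Finset α} {u v w : α} {x y : α → M}

/-- The values `x` after redirecting `u` into `w`: the value of `u` is added to that of `w`, and the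
deleted node `u` keeps the value zero. -/
def transfer (u w : α) (x : α → M) : α → M := fun v =>
  if v = u then 0 else if v = w then x u + x w else x v

theorem transfer_left (u w : α) (x : α → M) : transfer u w x u = 0 := if_pos rfl

theorem transfer_right (huw : u ≠ w) (x : α → M) : transfer u w x w = x u + x w := by
  rw [transfer, if_neg huw.symm, if_pos rfl]

theorem transfer_of_ne (hvu : v ≠ u) (hvw : v ≠ w) (x : α → M) : transfer u w x v = x v := by
  rw [transfer, if_neg hvu, if_neg hvw]

theorem transfer_zero (u w : α) : transfer u w (0 : α → M) = 0 := by
  ext v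
  simp [transfer]

theorem transfer_add (u w : α) (x y : α → M) :
    transfer u w (x + y) = transfer u w x + transfer u w y := by
  ext v
  simp only [transfer, Pi.add_apply]
  split_ifs
  exacts [(add_zero 0).symm, add_add_add_comm .., rfl]

theorem transfer_eq_zero (hw : w ∈ N) (hx : ∀ v ∉ N, x v = 0) (hv : v ∉ N.erase u) :
    transfer u w x v = 0 := by
  by_cases hvu : v = u
  · rw [hvu, transfer_left]
  · have hvN : v ∉ N := fun h => hv (Finset.mem_erase.2 ⟨hvu, h⟩)
    rw [transfer_of_ne hvu (ne_of_mem_of_not_mem hw hvN).symm, hx v hvN]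

theorem transfer_congr (hu : u ∈ N) (hw : w ∈ N) (h : ∀ v ∈ N, x v = y v) (hv : v ∈ N) :
    transfer u w x v = transfer u w y v := by
  simp only [transfer, h u hu, h w hw, h v hv]

theorem sum_erase_transfer (hu : u ∈ N) (hw : w ∈ N) (huw : u ≠ w) (x : α → M) :
    ∑ v ∈ N.erase u, transfer u w x v = ∑ v ∈ N, x v := by
  have hw' : w ∈ N.erase u := Finset.mem_erase.2 ⟨huw.symm, hw⟩
  rw [← Finset.add_sum_erase _ _ hw', ← Finset.add_sum_erase _ x hu, ← Finset.add_sum_erase _ x hw',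
    transfer_right huw, add_assoc]
  refine congrArg _ (congrArg _ (Finset.sum_congr rfl fun v hv => ?_))
  obtain ⟨hvw, hvu, -⟩ := by simpa only [Finset.mem_erase] using hv
  exact transfer_of_ne hvu hvw x

theorem transfer_nonneg {x : α → ℝ} (hu : u ∈ N) (hw : w ∈ N) (hx : ∀ v ∈ N, 0 ≤ x v)
    (hv : v ∈ N) : 0 ≤ transfer u w x v := by
  rw [transfer]
  split_ifs
  exacts [le_rfl, add_nonneg (hx u hu) (hx w hw), hx v hv]

theorem mul_transfer {g : α → ℝ} (hg : g u = g w) (x : α → ℝ) (v : α) :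
    g v * transfer u w x v = transfer u w (g * x) v := by
  simp only [transfer, Pi.mul_apply, mul_ite, mul_zero]
  split_ifs with hvu hvw
  · rfl
  · rw [hvw, hg, mul_add]
  · rfl

theorem coe_redirectWeights (b : α → ℝ≥0) (hvu : v ≠ u) :
    (redirectWeights b u w v : ℝ) = transfer u w (fun t => (b t : ℝ)) v := by
  by_cases hvw : v = w
  · subst hvw
    rw [transfer_right hvu.symm, redirectWeights, Function.update_self, NNReal.coe_add]
  · rw [transfer_of_ne hvu hvw, redirectWeights, Function.update_of_ne hvw]

end Transfer

namespace Multigraph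

variable {α : Type*} [DecidableEq α] {G : Multigraph α} {u v w t : α}

theorem inSum_congr {f g : α → ℝ} (h : ∀ t ∈ G.nodes, f t = g t) (v : α) :
    G.inSum f v = G.inSum g v := by
  simp only [inSum_eq_sum_mult]
  exact Finset.sum_congr rfl fun t ht => by rw [h t ht]

theorem edges_redirect (hw : w ∈ G.nodes) (huw : u ≠ w) :
    (G.redirect u w hw huw).edges = (G.edges.filter fun e => e.1 ≠ u ∧ e.2 ≠ u) +
      (G.edges.filter fun e => e.1 ≠ u ∧ e.2 = u).map fun e => (e.1, w) := by
  simp only [redirect, outEdges, inEdges, Multiset.sub_filter_eq_filter_not,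
    Multiset.filter_filter]
  congr 1
  ext e
  by_cases h₁ : e.1 = u <;> by_cases h₂ : e.2 = u <;> simp [h₁, h₂]

theorem mult_redirect (hw : w ∈ G.nodes) (huw : u ≠ w) (htu : t ≠ u) (hvu : v ≠ u) :
    (G.redirect u w hw huw).mult t v = transfer u w (G.mult t) v := by
  have hkept : (G.edges.filter fun e => e.1 ≠ u ∧ e.2 ≠ u).count (t, v) = G.mult t v :=
    Multiset.count_filter_of_pos ⟨htu, hvu⟩
  have hadded : ((G.edges.filter fun e => e.1 ≠ u ∧ e.2 = u).map fun e => (e.1, w)).count (t, v) =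
      if v = w then G.mult t u else 0 := by
    rw [Multiset.count_map, Multiset.filter_filter]
    split_ifs with hvw
    · rw [mult, Multiset.count_eq_card_filter_eq]
      exact congrArg _ (Multiset.filter_congr fun e _ => by grind)
    · rw [Multiset.card_eq_zero, Multiset.filter_eq_nil]
      grind
  rw [mult, edges_redirect, Multiset.count_add, hkept, hadded, transfer, if_neg hvu]
  split_ifs with hvw
  exacts [hvw ▸ add_comm .., rfl]

namespace OutTwins

/-- The graph that results from redirecting `u` into its out-twin `w`. -/
abbrev redirected (h : G.OutTwins u w) : Multigraph α := G.redirect u w h.2.1 h.2.2.1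

theorem sum_redirected_transfer {M : Type*} [AddCommMonoid M] (h : G.OutTwins u w) (x : α → M) :
    ∑ v ∈ h.redirected.nodes, transfer u w x v = ∑ v ∈ G.nodes, x v :=
  sum_erase_transfer h.1 h.2.1 h.2.2.1 x

theorem outDegree_redirected (h : G.OutTwins u w) (htu : t ≠ u) :
    h.redirected.outDegree t = G.outDegree t := by
  rw [outDegree_eq_sum_mult, outDegree_eq_sum_mult, ← h.sum_redirected_transfer]
  exact Finset.sum_congr rfl fun v hv => mult_redirect _ _ htu (Finset.ne_of_mem_erase hv)

theorem outDegree_eq (h : G.OutTwins u w) : G.outDegree u = G.outDegree w := by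
  rw [outDegree_eq_sum_mult, outDegree_eq_sum_mult]
  exact Finset.sum_congr rfl fun t _ => h.2.2.2 t

theorem inSum_redirected_transfer (h : G.OutTwins u w) (x : α → ℝ) (hvu : v ≠ u) :
    h.redirected.inSum (transfer u w x) v = transfer u w (G.inSum x) v := by
  let g : α → ℝ := fun t => (transfer u w (G.mult t) v : ℕ)
  have hg : g u = g w := by
    simp only [g, transfer, h.2.2.2]
  calc h.redirected.inSum (transfer u w x) v
      = ∑ t ∈ h.redirected.nodes, g t * transfer u w x t := by
        rw [inSum_eq_sum_mult]
        exact Finset.sum_congr rfl fun t ht => by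
          rw [mult_redirect _ _ (Finset.ne_of_mem_erase ht) hvu]
    _ = ∑ t ∈ G.nodes, g t * x t := by
        simp only [mul_transfer hg]
        exact h.sum_redirected_transfer (g * x)
    _ = transfer u w (G.inSum x) v := by
        simp only [g, transfer, if_neg hvu, inSum_eq_sum_mult]
        split_ifs
        · simp only [Nat.cast_add, add_mul, Finset.sum_add_distrib]
        · rfl

/-- All four recursive systems have this form, so that `transfer` maps solutions to solutions. -/
theorem transfer_eq_mul_inSum_add (h : G.OutTwins u w) {a : ℝ} {x f c : α → ℝ}
    (hx : ∀ v ∈ G.nodes, x v = a * G.inSum f v + c v) (hv : v ∈ h.redirected.nodes) :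
    transfer u w x v = a * h.redirected.inSum (transfer u w f) v + transfer u w c v := by
  obtain ⟨hvu, hvG⟩ := Finset.mem_erase.1 hv
  calc transfer u w x v = transfer u w ((fun _ => a) * G.inSum f + c) v :=
        transfer_congr h.1 h.2.1 hx hvG
    _ = a * transfer u w (G.inSum f) v + transfer u w c v := by
        rw [transfer_add, Pi.add_apply, ← mul_transfer (g := fun _ => a) rfl]
    _ = _ := by rw [h.inSum_redirected_transfer f hvu]

end OutTwins

end Multigraph

section NodeRedirect

theorem solutionOf_spec {α : Type*} {C : Multigraph α → Prop}
    {Sol : Multigraph α → (α → ℝ≥0) → (α → ℝ) → Prop} (h : WellPosedOn C Sol) {G : Multigraph α}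
    (hG : C G) (b : α → ℝ≥0) : Sol G b (solutionOf Sol G b) :=
  Classical.epsilon_spec (h G b hG).1.exists

variable {α : Type*} [DecidableEq α]

theorem nodeRedirectOn_solutionOf {C : Multigraph α → Prop}
    {Sol : Multigraph α → (α → ℝ≥0) → (α → ℝ) → Prop} (hwp : WellPosedOn C Sol)
    (hSol : ∀ {G b u w x} (h : G.OutTwins u w), C G → C h.redirected → Sol G b x →
      Sol h.redirected (redirectWeights b u w) (transfer u w x)) :
    NodeRedirectOn C (solutionOf Sol) := by
  intro G b u w h hG hG'
  rw [(hwp _ (redirectWeights b u w) hG').1.unique (solutionOf_spec hwp hG' _)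
    (hSol h hG hG' (solutionOf_spec hwp hG b))]
  exact ⟨fun v _ hvu hvw => (transfer_of_ne hvu hvw _).symm, (transfer_right h.2.2.1 _).symm⟩

theorem nodeRedirectOn_katzCentrality {a : ℝ} (ha : 0 < a) :
    NodeRedirectOn (α := α) (fun G => G.KatzClass a) (katzCentrality a) := by
  refine nodeRedirectOn_solutionOf (wellPosedOn_isKatz ha) fun {G b u w x} h _ _ hx => ?_
  refine ⟨fun v hv => ?_, fun v => transfer_eq_zero h.2.1 hx.2⟩
  rw [coe_redirectWeights b (Finset.ne_of_mem_erase hv)]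
  exact h.transfer_eq_mul_inSum_add hx.1 hv

theorem nodeRedirectOn_bonacichCentrality {a : ℝ} (ha : 0 < a) :
    NodeRedirectOn (α := α) (fun G => G.KatzClass a) (bonacichCentrality a) := by
  refine nodeRedirectOn_solutionOf (wellPosedOn_isBonacich ha) fun {G b u w x} h _ _ hx => ?_
  rw [isBonacich_iff] at hx ⊢
  refine ⟨fun v hv => ?_, fun v => transfer_eq_zero h.2.1 hx.2⟩
  rw [inSum_congr (fun t ht => coe_redirectWeights b (Finset.ne_of_mem_erase ht)) v,
    h.inSum_redirected_transfer (fun t => (b t : ℝ)) (Finset.ne_of_mem_erase hv)]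
  exact h.transfer_eq_mul_inSum_add hx.1 hv

theorem nodeRedirectOn_katzPrestige :
    NodeRedirectOn (α := α) StronglyConnected katzPrestige := by
  refine nodeRedirectOn_solutionOf wellPosedOn_isKatzPrestige fun {G b u w x} h _ _ hx => ?_
  refine ⟨fun v hv => ?_, (h.sum_redirected_transfer x).trans hx.2.1,
    fun v => transfer_eq_zero h.2.1 hx.2.2⟩
  have hdiv : ∀ t ∈ h.redirected.nodes, transfer u w x t / h.redirected.outDegree t =
      transfer u w (fun t => x t / G.outDegree t) t := fun t ht => by
    rw [h.outDegree_redirected (Finset.ne_of_mem_erase ht), div_eq_inv_mul,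
      mul_transfer (g := fun t => (G.outDegree t : ℝ)⁻¹) (by rw [h.outDegree_eq])]
    simp only [div_eq_inv_mul, Pi.mul_def]
  have heq : ∀ v ∈ G.nodes, x v = G.inSum (fun t => x t / G.outDegree t) v := hx.1
  calc transfer u w x v = h.redirected.inSum (transfer u w fun t => x t / G.outDegree t) v := by
        simpa [transfer_zero] using h.transfer_eq_mul_inSum_add (a := 1) (c := 0) (by simpa) hv
    _ = h.redirected.inSum (fun t => transfer u w x t / h.redirected.outDegree t) v :=
        (inSum_congr hdiv v).symm

theorem nodeRedirectOn_eigenvectorCentrality :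
    NodeRedirectOn (α := α) StronglyConnected eigenvectorCentrality := by
  refine nodeRedirectOn_solutionOf wellPosedOn_isEigenvector fun {G b u w x} h hG hG' hx => ?_
  have hsum := (h.sum_redirected_transfer x).trans hx.2.1
  have heq : ∀ v ∈ G.nodes, x v = 1 / G.eigenMax * G.inSum x v := hx.1
  have heq' : ∀ v ∈ h.redirected.nodes,
      transfer u w x v = 1 / G.eigenMax * h.redirected.inSum (transfer u w x) v := fun v hv => by
    simpa [transfer_zero] using h.transfer_eq_mul_inSum_add (c := 0) (by simpa using heq) hv
  have hnonneg : ∀ v ∈ h.redirected.nodes, 0 ≤ transfer u w x v := fun v hv =>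
    transfer_nonneg h.1 h.2.1 ((wellPosedOn_isEigenvector G b hG).2 x hx)
      (Finset.mem_of_mem_erase hv)
  have hmax : h.redirected.eigenMax = G.eigenMax :=
    hG'.eigenMax_eq_of_nonneg hnonneg (by rw [hsum]; exact one_ne_zero) fun v hv => by
      rw [heq' v hv, ← mul_assoc, mul_one_div_cancel hG.eigenMax_pos.ne', one_mul]
  exact ⟨by rwa [hmax], hsum, fun v => transfer_eq_zero h.2.1 hx.2.2⟩

end NodeRedirect

namespace Multigraph

variable {α : Type*} {G : Multigraph α} {s t v : α} {k : ℕ}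

theorem hasPath_one_iff : G.HasPath 1 s t ↔ (s, t) ∈ G.edges := by
  constructor
  · rintro ⟨p, ⟨-, hp⟩, rfl, rfl⟩
    exact hp 0
  · exact fun h => ⟨![s, t], ⟨le_rfl, fun i => by fin_cases i; exact h⟩, rfl, rfl⟩

theorem hasPath_two (hsv : (s, v) ∈ G.edges) (hvt : (v, t) ∈ G.edges) : G.HasPath 2 s t :=
  ⟨![s, v, t], ⟨one_le_two, fun i => by fin_cases i; exacts [hsv, hvt]⟩, rfl, rfl⟩

theorem HasPath.one_le (h : G.HasPath k s t) : 1 ≤ k := by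
  obtain ⟨p, ⟨hk, -⟩, -⟩ := h
  exact hk

theorem dist_eq_one (hst : (s, t) ∈ G.edges) : G.dist s t = 1 :=
  IsLeast.csInf_eq ⟨hasPath_one_iff.2 hst, fun _ => HasPath.one_le⟩

theorem dist_eq_two (hsv : (s, v) ∈ G.edges) (hvt : (v, t) ∈ G.edges) (hst : (s, t) ∉ G.edges) :
    G.dist s t = 2 := by
  refine IsLeast.csInf_eq ⟨hasPath_two hsv hvt, fun k hk => hk.one_le.lt_of_ne ?_⟩
  rintro rfl
  exact hst (hasPath_one_iff.1 hk)

end Multigraph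

variable {α : Type*} [DecidableEq α]

namespace Multigraph

variable {G : Multigraph α} {s t v : α}

theorem stronglyConnected_of_hub (hv : v ∈ G.nodes) (hne : (G.nodes.erase v).Nonempty)
    (hub : ∀ x ∈ G.nodes.erase v, (x, v) ∈ G.edges ∧ (v, x) ∈ G.edges) : G.StronglyConnected := by
  refine ⟨⟨v, hv⟩, fun x hx y hy => ?_⟩
  by_cases hxv : x = v <;> by_cases hyv : y = v
  · obtain ⟨z, hz⟩ := hne
    rw [hxv, hyv]
    exact ⟨2, hasPath_two (hub z hz).2 (hub z hz).1⟩
  · rw [hxv]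
    exact ⟨1, hasPath_one_iff.2 (hub y (Finset.mem_erase.2 ⟨hyv, hy⟩)).2⟩
  · rw [hyv]
    exact ⟨1, hasPath_one_iff.2 (hub x (Finset.mem_erase.2 ⟨hxv, hx⟩)).1⟩
  · exact ⟨2, hasPath_two (hub x (Finset.mem_erase.2 ⟨hxv, hx⟩)).1
      (hub y (Finset.mem_erase.2 ⟨hyv, hy⟩)).2⟩

theorem numShortest_ne_zero (hsv : (s, v) ∈ G.edges) (hvt : (v, t) ∈ G.edges)
    (hst : (s, t) ∉ G.edges) : G.numShortest s t ≠ 0 := by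
  rw [numShortest, dist_eq_two hsv hvt hst, numPaths]
  refine (Finset.sum_pos' (fun _ _ => Nat.zero_le _) ⟨![s, v, t], ?_, ?_⟩).ne'
  · refine Finset.mem_filter.2 ⟨Fintype.mem_piFinset.2 fun i => ?_, rfl, rfl⟩
    fin_cases i
    exacts [G.fst_mem _ hsv, G.snd_mem _ hsv, G.snd_mem _ hvt]
  · refine Finset.prod_pos fun i _ => Multiset.count_pos.2 ?_
    fin_cases i
    exacts [hsv, hvt]

theorem numShortestThrough_eq_numShortest (hs : ∀ x, (s, x) ∈ G.edges → x = v)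
    (hdist : 1 ≤ G.dist s t) : G.numShortestThrough s t v = G.numShortest s t := by
  rw [numShortest, numShortestThrough, numPaths, numPathsThrough]
  obtain ⟨k, hk⟩ := Nat.exists_eq_add_of_le' hdist
  rw [hk]
  refine Finset.sum_filter_of_ne fun p hp hne => ⟨1, hs _ ?_⟩
  rw [← (Finset.mem_filter.1 hp).2.1]
  exact Multiset.count_ne_zero.1 (Finset.prod_ne_zero_iff.1 hne 0 (Finset.mem_univ _))

end Multigraph

section ExplicitMeasures

variable {G : Multigraph α} {v : α}

theorem closenessCentrality_of_forall_mem_edges (h : ∀ x ∈ G.nodes.erase v, (x, v) ∈ G.edges)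
    (b : α → ℝ≥0) : closenessCentrality G b v = 1 / ((G.nodes.erase v).card : ℝ) := by
  rw [closenessCentrality, Finset.sum_congr rfl fun x hx => by rw [dist_eq_one (h x hx)]]
  simp

theorem decayCentrality_of_forall_mem_edges (h : ∀ x ∈ G.nodes.erase v, (x, v) ∈ G.edges) (a : ℝ)
    (b : α → ℝ≥0) : decayCentrality a G b v = (G.nodes.erase v).card * a := by
  rw [decayCentrality, Finset.sum_congr rfl fun x hx => by
    rw [dist_eq_one (h x hx), if_pos ⟨1, hasPath_one_iff.2 (h x hx)⟩, pow_one]]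
  simp

theorem betweennessCentrality_of_nodes_erase_eq_singleton {x : α} (h : G.nodes.erase v = {x})
    (b : α → ℝ≥0) : betweennessCentrality G b v = 0 := by
  rw [betweennessCentrality, h, Finset.sum_singleton, Finset.filter_singleton]
  simp

end ExplicitMeasures

section ExampleGraph

variable {u v w : α}

theorem outTwins_exampleGraph (huw : u ≠ w) (huv : u ≠ v) (hvw : v ≠ w) :
    (exampleGraph u v w).OutTwins u w := by
  refine ⟨by simp [exampleGraph], mem_exampleGraph u v w, huw, fun t => ?_⟩
  simp [mult, exampleGraph, Multiset.count_cons, huw, huw.symm, huv, hvw.symm]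

theorem inEdges_exampleGraph (huv : u ≠ v) (hvw : v ≠ w) :
    (exampleGraph u v w).inEdges v = {(u, v), (w, v)} := by
  simp [inEdges, exampleGraph, Multiset.filter_singleton, huv, hvw.symm]

theorem outDegree_exampleGraph_left (huw : u ≠ w) (huv : u ≠ v) :
    (exampleGraph u v w).outDegree u = 1 := by
  simp [outDegree, outEdges, exampleGraph, Multiset.filter_singleton, huv.symm, huw.symm]

theorem nodes_erase_exampleGraph (huv : u ≠ v) (hvw : v ≠ w) :
    (exampleGraph u v w).nodes.erase v = {u, w} := by
  ext x
  simp only [exampleGraph, Finset.mem_erase, Finset.mem_insert, Finset.mem_singleton]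
  grind

theorem mem_edges_exampleGraph {x y : α} :
    (x, y) ∈ (exampleGraph u v w).edges ↔
      (x = u ∨ x = w) ∧ y = v ∨ x = v ∧ (y = u ∨ y = w) := by
  simp only [exampleGraph, Multiset.insert_eq_cons, Multiset.mem_cons, Multiset.mem_singleton,
    Prod.mk.injEq]
  tauto

theorem exampleGraph_hub (huv : u ≠ v) (hvw : v ≠ w) :
    ∀ x ∈ (exampleGraph u v w).nodes.erase v,
      (x, v) ∈ (exampleGraph u v w).edges ∧ (v, x) ∈ (exampleGraph u v w).edges := by
  simp [nodes_erase_exampleGraph huv hvw, mem_edges_exampleGraph]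

theorem stronglyConnected_exampleGraph (huv : u ≠ v) (hvw : v ≠ w) :
    (exampleGraph u v w).StronglyConnected :=
  stronglyConnected_of_hub (v := v) (by simp [exampleGraph])
    (by simp [nodes_erase_exampleGraph huv hvw]) (exampleGraph_hub huv hvw)

theorem degreeCentrality_exampleGraph (huv : u ≠ v) (hvw : v ≠ w) (b : α → ℝ≥0) :
    degreeCentrality (exampleGraph u v w) b v = 2 := by
  simp [degreeCentrality, inEdges_exampleGraph huv hvw]

theorem betaMeasure_exampleGraph (huw : u ≠ w) (huv : u ≠ v) (hvw : v ≠ w) (b : α → ℝ≥0) :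
    betaMeasure (exampleGraph u v w) b v = 2 := by
  have hw : (exampleGraph u v w).outDegree w = 1 :=
    (outTwins_exampleGraph huw huv hvw).outDegree_eq ▸ outDegree_exampleGraph_left huw huv
  simp [betaMeasure, inEdges_exampleGraph huv hvw, outDegree_exampleGraph_left huw huv, hw,
    one_add_one_eq_two]

theorem closenessCentrality_exampleGraph (huw : u ≠ w) (huv : u ≠ v) (hvw : v ≠ w) (b : α → ℝ≥0) :
    closenessCentrality (exampleGraph u v w) b v = 1 / 2 := by
  rw [closenessCentrality_of_forall_mem_edges fun x hx => (exampleGraph_hub huv hvw x hx).1,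
    nodes_erase_exampleGraph huv hvw, Finset.card_pair huw, Nat.cast_two]

theorem decayCentrality_exampleGraph (huw : u ≠ w) (huv : u ≠ v) (hvw : v ≠ w) (a : ℝ)
    (b : α → ℝ≥0) : decayCentrality a (exampleGraph u v w) b v = 2 * a := by
  rw [decayCentrality_of_forall_mem_edges fun x hx => (exampleGraph_hub huv hvw x hx).1,
    nodes_erase_exampleGraph huv hvw, Finset.card_pair huw, Nat.cast_two]

theorem numShortest_exampleGraph {s t : α} (huv : u ≠ v) (hvw : v ≠ w) (hs : s = u ∨ s = w)
    (ht : t = u ∨ t = w) : (exampleGraph u v w).numShortest s t ≠ 0 ∧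
      (exampleGraph u v w).numShortestThrough s t v = (exampleGraph u v w).numShortest s t := by
  have hsv : (s, v) ∈ (exampleGraph u v w).edges := mem_edges_exampleGraph.2 (.inl ⟨hs, rfl⟩)
  have hvt : (v, t) ∈ (exampleGraph u v w).edges := mem_edges_exampleGraph.2 (.inr ⟨rfl, ht⟩)
  have honly : ∀ x, (s, x) ∈ (exampleGraph u v w).edges → x = v := fun x hx => by
    grind [mem_edges_exampleGraph]
  have hst : (s, t) ∉ (exampleGraph u v w).edges := fun h => by
    grind
  exact ⟨numShortest_ne_zero hsv hvt hst,
    numShortestThrough_eq_numShortest honly ((dist_eq_two hsv hvt hst).symm ▸ one_le_two)⟩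

theorem betweennessCentrality_exampleGraph (huw : u ≠ w) (huv : u ≠ v) (hvw : v ≠ w)
    (b : α → ℝ≥0) : betweennessCentrality (exampleGraph u v w) b v = 2 := by
  obtain ⟨huw₀, huwv⟩ := numShortest_exampleGraph huv hvw (.inl rfl) (.inr rfl)
  obtain ⟨hwu₀, hwuv⟩ := numShortest_exampleGraph huv hvw (.inr rfl) (.inl rfl)
  simp only [betweennessCentrality, nodes_erase_exampleGraph huv hvw, Finset.sum_filter,
    Finset.sum_pair huw]
  simp [huw, huw.symm, huw₀, hwu₀, huwv, hwuv, one_add_one_eq_two]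

/-- The graph with nodes `v`, `w` and edges `(w, v)`, `(v, w)`, `(v, w)` that results from the
example by redirecting `u` into `w`. -/
abbrev redirectedExampleGraph (u v w : α) (huw : u ≠ w) : Multigraph α :=
  (exampleGraph u v w).redirect u w (mem_exampleGraph u v w) huw

theorem edges_redirectedExampleGraph (huw : u ≠ w) (huv : u ≠ v) :
    (redirectedExampleGraph u v w huw).edges = {(w, v), (v, w), (v, w)} := by
  rw [edges_redirect]
  simp [exampleGraph, Multiset.filter_singleton, huw.symm, huv.symm]

theorem nodes_erase_redirectedExampleGraph (huw : u ≠ w) (hvw : v ≠ w) :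
    (redirectedExampleGraph u v w huw).nodes.erase v = {w} := by
  ext x
  simp only [redirect, exampleGraph, Finset.mem_erase, Finset.mem_insert, Finset.mem_singleton]
  grind

theorem redirectedExampleGraph_hub (huw : u ≠ w) (huv : u ≠ v) (hvw : v ≠ w) :
    ∀ x ∈ (redirectedExampleGraph u v w huw).nodes.erase v,
      (x, v) ∈ (redirectedExampleGraph u v w huw).edges ∧
        (v, x) ∈ (redirectedExampleGraph u v w huw).edges := by
  simp [nodes_erase_redirectedExampleGraph huw hvw, edges_redirectedExampleGraph huw huv]

theorem stronglyConnected_redirectedExampleGraph (huw : u ≠ w) (huv : u ≠ v) (hvw : v ≠ w) :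
    (redirectedExampleGraph u v w huw).StronglyConnected :=
  stronglyConnected_of_hub (v := v) (by simp [redirect, exampleGraph, huv.symm])
    (by simp [nodes_erase_redirectedExampleGraph huw hvw]) (redirectedExampleGraph_hub huw huv hvw)

theorem inEdges_redirectedExampleGraph (huw : u ≠ w) (huv : u ≠ v) (hvw : v ≠ w) :
    (redirectedExampleGraph u v w huw).inEdges v = {(w, v)} := by
  rw [inEdges, edges_redirectedExampleGraph huw huv]
  simp [Multiset.filter_singleton, hvw.symm]

theorem degreeCentrality_redirectedExampleGraph (huw : u ≠ w) (huv : u ≠ v) (hvw : v ≠ w)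
    (b : α → ℝ≥0) : degreeCentrality (redirectedExampleGraph u v w huw) b v = 1 := by
  rw [degreeCentrality, inEdges_redirectedExampleGraph huw huv hvw, Multiset.card_singleton,
    Nat.cast_one]

theorem betaMeasure_redirectedExampleGraph (huw : u ≠ w) (huv : u ≠ v) (hvw : v ≠ w)
    (b : α → ℝ≥0) : betaMeasure (redirectedExampleGraph u v w huw) b v = 1 := by
  have hw : (redirectedExampleGraph u v w huw).outDegree w = 1 := by
    rw [outDegree, outEdges, edges_redirectedExampleGraph huw huv]
    simp [Multiset.filter_singleton, hvw]
  simp [betaMeasure, inEdges_redirectedExampleGraph huw huv hvw, hw]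

theorem closenessCentrality_redirectedExampleGraph (huw : u ≠ w) (huv : u ≠ v) (hvw : v ≠ w)
    (b : α → ℝ≥0) : closenessCentrality (redirectedExampleGraph u v w huw) b v = 1 := by
  rw [closenessCentrality_of_forall_mem_edges
      fun x hx => (redirectedExampleGraph_hub huw huv hvw x hx).1,
    nodes_erase_redirectedExampleGraph huw hvw, Finset.card_singleton, Nat.cast_one, one_div_one]

theorem decayCentrality_redirectedExampleGraph (huw : u ≠ w) (huv : u ≠ v) (hvw : v ≠ w) (a : ℝ)
    (b : α → ℝ≥0) : decayCentrality a (redirectedExampleGraph u v w huw) b v = a := by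
  rw [decayCentrality_of_forall_mem_edges
      fun x hx => (redirectedExampleGraph_hub huw huv hvw x hx).1,
    nodes_erase_redirectedExampleGraph huw hvw, Finset.card_singleton, Nat.cast_one, one_mul]

theorem betweennessCentrality_redirectedExampleGraph (huw : u ≠ w) (hvw : v ≠ w) (b : α → ℝ≥0) :
    betweennessCentrality (redirectedExampleGraph u v w huw) b v = 0 :=
  betweennessCentrality_of_nodes_erase_eq_singleton (nodes_erase_redirectedExampleGraph huw hvw) b

theorem not_nodeRedirectOn_of_exampleGraph {C : Multigraph α → Prop} {F : Centrality α} {r r' : ℝ}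
    (huw : u ≠ w) (huv : u ≠ v) (hvw : v ≠ w) (hC : C (exampleGraph u v w))
    (hC' : C (redirectedExampleGraph u v w huw)) (hF : ∀ b, F (exampleGraph u v w) b v = r)
    (hF' : ∀ b, F (redirectedExampleGraph u v w huw) b v = r') (hr : r ≠ r') :
    ¬ NodeRedirectOn C F := fun h => hr <| by
  rw [← hF 0, ← hF' (redirectWeights 0 u w)]
  exact (h _ 0 u w (outTwins_exampleGraph huw huv hvw) hC hC').1 v (by simp [exampleGraph])
    huv.symm hvw

theorem not_nodeRedirectOn_degreeCentrality (huw : u ≠ w) (huv : u ≠ v) (hvw : v ≠ w) :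
    ¬ NodeRedirectOn (α := α) (fun _ => True) degreeCentrality :=
  not_nodeRedirectOn_of_exampleGraph huw huv hvw trivial trivial
    (degreeCentrality_exampleGraph huv hvw) (degreeCentrality_redirectedExampleGraph huw huv hvw)
    (by norm_num)

theorem not_nodeRedirectOn_betaMeasure (huw : u ≠ w) (huv : u ≠ v) (hvw : v ≠ w) :
    ¬ NodeRedirectOn (α := α) (fun _ => True) betaMeasure :=
  not_nodeRedirectOn_of_exampleGraph huw huv hvw trivial trivial
    (betaMeasure_exampleGraph huw huv hvw) (betaMeasure_redirectedExampleGraph huw huv hvw)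
    (by norm_num)

theorem not_nodeRedirectOn_closenessCentrality (huw : u ≠ w) (huv : u ≠ v) (hvw : v ≠ w) :
    ¬ NodeRedirectOn (α := α) StronglyConnected closenessCentrality :=
  not_nodeRedirectOn_of_exampleGraph huw huv hvw (stronglyConnected_exampleGraph huv hvw)
    (stronglyConnected_redirectedExampleGraph huw huv hvw)
    (closenessCentrality_exampleGraph huw huv hvw)
    (closenessCentrality_redirectedExampleGraph huw huv hvw) (by norm_num)

theorem not_nodeRedirectOn_decayCentrality (huw : u ≠ w) (huv : u ≠ v) (hvw : v ≠ w) {a : ℝ}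
    (ha : a ≠ 0) : ¬ NodeRedirectOn (α := α) (fun _ => True) (decayCentrality a) :=
  not_nodeRedirectOn_of_exampleGraph huw huv hvw trivial trivial
    (decayCentrality_exampleGraph huw huv hvw a)
    (decayCentrality_redirectedExampleGraph huw huv hvw a) fun h => ha (by linarith)

theorem not_nodeRedirectOn_betweennessCentrality (huw : u ≠ w) (huv : u ≠ v) (hvw : v ≠ w) :
    ¬ NodeRedirectOn (α := α) (fun _ => True) betweennessCentrality :=
  not_nodeRedirectOn_of_exampleGraph huw huv hvw trivial trivial
    (betweennessCentrality_exampleGraph huw huv hvw)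
    (betweennessCentrality_redirectedExampleGraph huw hvw) (by norm_num)

end ExampleGraph

end CentralityAxioms

open CentralityAxioms Multigraph in
theorem mainTheorem9_general {α : Type*} [DecidableEq α] (hα : 3 ≤ ENat.card α) :
    (WellPosedOn (α := α) StronglyConnected IsEigenvector ∧
      WellPosedOn (α := α) StronglyConnected IsKatzPrestige ∧
      (∀ a : ℝ, 0 < a → WellPosedOn (α := α) (fun G => G.KatzClass a) (IsKatz a)) ∧
      (∀ a : ℝ, 0 < a → WellPosedOn (α := α) (fun G => G.KatzClass a) (IsBonacich a))) ∧
    (NodeRedirectOn (α := α) StronglyConnected eigenvectorCentrality ∧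
      NodeRedirectOn (α := α) StronglyConnected katzPrestige ∧
      (∀ a : ℝ, 0 < a → NodeRedirectOn (α := α) (fun G => G.KatzClass a) (katzCentrality a)) ∧
      (∀ a : ℝ, 0 < a →
        NodeRedirectOn (α := α) (fun G => G.KatzClass a) (bonacichCentrality a))) ∧
    (¬ NodeRedirectOn (α := α) (fun _ => True) degreeCentrality ∧
      ¬ NodeRedirectOn (α := α) (fun _ => True) betaMeasure ∧
      ¬ NodeRedirectOn (α := α) StronglyConnected closenessCentrality ∧
      (∀ a : ℝ, a ≠ 0 → ¬ NodeRedirectOn (α := α) (fun _ => True) (decayCentrality a)) ∧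
      ¬ NodeRedirectOn (α := α) (fun _ => True) betweennessCentrality) ∧
    (∀ (u v w : α) (huw : u ≠ w), u ≠ v → v ≠ w →
      let G := exampleGraph u v w
      let G' := redirectedExampleGraph u v w huw
      let b : α → ℝ≥0 := fun _ => 1
      let b' := redirectWeights b u w
      G.OutTwins u w ∧ G.StronglyConnected ∧ G'.StronglyConnected ∧
      degreeCentrality G b v = 2 ∧ degreeCentrality G' b' v = 1 ∧
      betaMeasure G b v = 2 ∧ betaMeasure G' b' v = 1 ∧
      closenessCentrality G b v = 1 / 2 ∧ closenessCentrality G' b' v = 1 ∧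
      (∀ a : ℝ, decayCentrality a G b v = 2 * a ∧ decayCentrality a G' b' v = a) ∧
      betweennessCentrality G b v = 2 ∧ betweennessCentrality G' b' v = 0) := by
  refine ⟨⟨wellPosedOn_isEigenvector, wellPosedOn_isKatzPrestige,
      fun a => wellPosedOn_isKatz, fun a => wellPosedOn_isBonacich⟩,
    ⟨nodeRedirectOn_eigenvectorCentrality, nodeRedirectOn_katzPrestige,
      fun a => nodeRedirectOn_katzCentrality, fun a => nodeRedirectOn_bonacichCentrality⟩,
    ?_, fun u v w huw huv hvw => ?_⟩
  · have : Nontrivial α :=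
      (ENat.one_lt_card_iff_nontrivial α).1 (lt_of_lt_of_le (by norm_num) hα)
    obtain ⟨u, w, huw⟩ := exists_pair_ne α
    obtain ⟨v, hvu, hvw⟩ := ENat.exists_ne_ne_of_three_le hα u w
    exact ⟨not_nodeRedirectOn_degreeCentrality huw hvu.symm hvw,
      not_nodeRedirectOn_betaMeasure huw hvu.symm hvw,
      not_nodeRedirectOn_closenessCentrality huw hvu.symm hvw,
      fun a ha => not_nodeRedirectOn_decayCentrality huw hvu.symm hvw ha,
      not_nodeRedirectOn_betweennessCentrality huw hvu.symm hvw⟩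
  · exact ⟨outTwins_exampleGraph huw huv hvw, stronglyConnected_exampleGraph huv hvw,
      stronglyConnected_redirectedExampleGraph huw huv hvw,
      degreeCentrality_exampleGraph huv hvw _,
      degreeCentrality_redirectedExampleGraph huw huv hvw _,
      betaMeasure_exampleGraph huw huv hvw _,
      betaMeasure_redirectedExampleGraph huw huv hvw _,
      closenessCentrality_exampleGraph huw huv hvw _,
      closenessCentrality_redirectedExampleGraph huw huv hvw _,
      fun a => ⟨decayCentrality_exampleGraph huw huv hvw a _,
        decayCentrality_redirectedExampleGraph huw huv hvw a _⟩,
      betweennessCentrality_exampleGraph huw huv hvw _,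
      betweennessCentrality_redirectedExampleGraph huw hvw _⟩

theorem mainTheorem9 {α : Type*} [DecidableEq α] [Infinite α] :
    -- the four recursively defined centralities are well defined on their classes of graphs
    (CentralityAxioms.WellPosedOn (α := α) CentralityAxioms.Multigraph.StronglyConnected
        CentralityAxioms.IsEigenvector ∧
      CentralityAxioms.WellPosedOn (α := α) CentralityAxioms.Multigraph.StronglyConnected
        CentralityAxioms.IsKatzPrestige ∧
      (∀ a : ℝ, 0 < a → a < 1 →
        CentralityAxioms.WellPosedOn (α := α) (fun G => G.KatzClass a)
          (CentralityAxioms.IsKatz a)) ∧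
      (∀ a : ℝ, 0 < a → a < 1 →
        CentralityAxioms.WellPosedOn (α := α) (fun G => G.KatzClass a)
          (CentralityAxioms.IsBonacich a))) ∧
    -- and satisfy Node Redirect there
    (CentralityAxioms.NodeRedirectOn (α := α) CentralityAxioms.Multigraph.StronglyConnected
        CentralityAxioms.eigenvectorCentrality ∧
      CentralityAxioms.NodeRedirectOn (α := α) CentralityAxioms.Multigraph.StronglyConnected
        CentralityAxioms.katzPrestige ∧
      (∀ a : ℝ, 0 < a → a < 1 →
        CentralityAxioms.NodeRedirectOn (α := α) (fun G => G.KatzClass a)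
          (CentralityAxioms.katzCentrality a)) ∧
      (∀ a : ℝ, 0 < a → a < 1 →
        CentralityAxioms.NodeRedirectOn (α := α) (fun G => G.KatzClass a)
          (CentralityAxioms.bonacichCentrality a))) ∧
    -- the five other measures do not satisfy Node Redirect
    (¬ CentralityAxioms.NodeRedirectOn (α := α) (fun _ => True)
        CentralityAxioms.degreeCentrality ∧
      ¬ CentralityAxioms.NodeRedirectOn (α := α) (fun _ => True)
        CentralityAxioms.betaMeasure ∧
      ¬ CentralityAxioms.NodeRedirectOn (α := α) CentralityAxioms.Multigraph.StronglyConnected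
        CentralityAxioms.closenessCentrality ∧
      (∀ a : ℝ, 0 < a → a < 1 →
        ¬ CentralityAxioms.NodeRedirectOn (α := α) (fun _ => True)
          (CentralityAxioms.decayCentrality a)) ∧
      ¬ CentralityAxioms.NodeRedirectOn (α := α) (fun _ => True)
        CentralityAxioms.betweennessCentrality) ∧
    -- as one strongly connected example shows
    (∀ (u v w : α) (huw : u ≠ w), u ≠ v → v ≠ w →
      let G := CentralityAxioms.exampleGraph u v w
      let G' := G.redirect u w (CentralityAxioms.mem_exampleGraph u v w) huw
      let b : α → NNReal := fun _ => 1
      let b' : α → NNReal := CentralityAxioms.redirectWeights b u w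
      G.OutTwins u w ∧ G.StronglyConnected ∧ G'.StronglyConnected ∧
      CentralityAxioms.degreeCentrality G b v = 2 ∧
      CentralityAxioms.degreeCentrality G' b' v = 1 ∧
      CentralityAxioms.betaMeasure G b v = 2 ∧
      CentralityAxioms.betaMeasure G' b' v = 1 ∧
      CentralityAxioms.closenessCentrality G b v = 1 / 2 ∧
      CentralityAxioms.closenessCentrality G' b' v = 1 ∧
      (∀ a : ℝ, 0 < a → a < 1 →
        CentralityAxioms.decayCentrality a G b v = 2 * a ∧
        CentralityAxioms.decayCentrality a G' b' v = a) ∧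
      CentralityAxioms.betweennessCentrality G b v = 2 ∧
      CentralityAxioms.betweennessCentrality G' b' v = 0) := by
  obtain ⟨⟨hEig, hPrestige, hKatz, hBonacich⟩, ⟨rEig, rPrestige, rKatz, rBonacich⟩,
    ⟨nDegree, nBeta, nCloseness, nDecay, nBetweenness⟩, hExample⟩ :=
    mainTheorem9_general (α := α) (by simp [ENat.card_eq_top_of_infinite])
  refine ⟨⟨hEig, hPrestige, fun a ha _ => hKatz a ha, fun a ha _ => hBonacich a ha⟩,
    ⟨rEig, rPrestige, fun a ha _ => rKatz a ha, fun a ha _ => rBonacich a ha⟩,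
    ⟨nDegree, nBeta, nCloseness, fun a ha _ => nDecay a ha.ne', nBetweenness⟩,
    fun u v w huw huv hvw => ?_⟩
  obtain ⟨hTwins, hG, hG', hD, hD', hβ, hβ', hC, hC', hY, hB⟩ := hExample u v w huw huv hvw
  exact ⟨hTwins, hG, hG', hD, hD', hβ, hβ', hC, hC', fun a _ _ => hY a, hB⟩
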